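/- Let $q$ be a nonzero complex number with $q^m\neq 1$ for all integers $m\ge 1$, and let $c\in\mathbb{C}$ be such that $c^2$ is a nonzero real number. For an integer $N\ge 3$ put $i'=N+1-i$ for $1\le i\le N$; let $\rho_i=N/2-i$ if $i<i'$, $\rho_i=-(N/2-i')$ if $i'<i$, and $\rho_i=0$ if $i=i'$; and set $$C^{ij}=C_{ij}=q^{-2\rho_i}\delta_{ij'},\qquad K^{ij}_{kl}=C^{ij}C_{kl},$$ $$\hat R^{ij}_{kl}=q^{2\delta_{ij}-2\delta_{ij'}}\delta_{il}\delta_{jk}+(q^2-q^{-2})\delta_{i<l}\bigl(\delta_{ik}\delta_{jl}-K^{ij}_{kl}\bigr),$$ $$P_+=\frac{1}{q^2+q^{-2}}\Bigl(q^{-2}\,\mathrm{id}+\hat R-\frac{q^2-q^{-2}}{q^{2N}-1}K\Bigr),$$ where $\delta_{i<l}=1$ if $i<l$ and $\delta_{i<l}=0$ otherwise. Let $\mathrm{Cl}_q(N)$ be the unital complex algebra generated by $\gamma_1,\dots,\gamma_N$ with the relations $$\sum_{k,l}(P_+)^{kl}_{ij}\gamma_k\gamma_l=0\quad(1\le i,j\le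 N),\qquad \sum_{i,j}C^{ij}\gamma_i\gamma_j=c^2\,\frac{q^{2N}-1}{q^2-1}.$$ Let $\mathrm{Cl}_q(N)_{0}$ and $\mathrm{Cl}_q(N)_{1}$ be the linear spans of the products of an even, respectively odd, number of generators. For $J=(j_1,\dots,j_n)\in\{0,1\}^n$ put $\ell(J)=\sum_k j_k$ and $L(J)=\sum_k k\,j_k$. Define $$z_0=\sum_{k=0}^n(-1)^k\prod_{l=1}^k\frac{q^{2l-2}+q^{-2l+2}}{q(q+q^{-1})c^2}\sum_{\ell(J)=k}q^{2L(J)-k(2n-k+1)}\gamma_1^{j_1}\cdots\gamma_n^{j_n}\gamma_{n'}^{j_n}\cdots\gamma_{1'}^{j_1}\in\mathrm{Cl}_q(2n)\quad(n\ge 2),$$ $$z_1=\frac1c\sum_{k=0}^n\prod_{l=1}^k\frac{q^{2l-1}+q^{-2l+1}}{q(q+q^{-1})c^2}\sum_{\ell(J)=k}q^{2L(J)-k(2n-k+1)}\gamma_1^{j_1}\cdots\gamma_n^{j_n}\gamma_{n+1}\gamma_{n'}^{j_n}\cdots\gamma_{1'}^{j_1}\in\mathrm{Cl}_q(2n+1)\quad(n\ge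 1).$$ Let $\varphi=\gamma_{n+1}\gamma_{n+2}\cdots\gamma_{2n}\in\mathrm{Cl}_q(2n)$, and for $\eta\in\{1,-1\}$ let $\varphi^\eta=(\eta c+\gamma_{n+1})\gamma_{n+2}\cdots\gamma_{2n+1}\in\mathrm{Cl}_q(2n+1)$ and $I_L^\eta=\mathrm{Cl}_q(2n+1)\varphi^\eta$. Then: (a) for $n\ge 2$: $z_0^2=1$ in $\mathrm{Cl}_q(2n)$, and $z_0x=x$ for all $x\in\mathrm{Cl}_q(2n)_0\,\varphi$, and $z_0x=-x$ for all $x\in\mathrm{Cl}_q(2n)_1\,\varphi$; (b) for $n\ge 1$: $z_1^2=1$ in $\mathrm{Cl}_q(2n+1)$, and $z_1x=\eta x$ for all $x\in I_L^\eta$, $\eta\in\{1,-1\}$. -/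

import Mathlib

/-!
# The FRT--Clifford algebra

The indices `1, …, N` of the generators are represented by `Fin N`, so that the index `i : Fin N` stands for
the number `i + 1`; the involution `i ↦ i' = N + 1 - i` is `Fin.rev`.
-/

namespace FRTClifford

noncomputable section

/-- The integer `2 ρ_i`, where `ρ_i = N/2 - i` if `i < i'`, `ρ_i = -(N/2 - i')` if `i' < i`
and `ρ_i = 0` if `i = i'`. -/
def twoRho (N : ℕ) (i : Fin N) : ℤ :=
  (if i < i.rev then (N : ℤ) - 2 * ((i : ℤ) + 1) else 0)
    - (if i.rev < i then (N : ℤ) - 2 * ((i.rev : ℤ) + 1) else 0)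

/-- The metric `C^{ij} = C_{ij} = q^{-2ρ_i} δ_{i j'}`. -/
def metricC (q : ℂ) (N : ℕ) (i j : Fin N) : ℂ :=
  if i = j.rev then q ^ (-twoRho N i) else 0

/-- `K^{ij}_{kl} = C^{ij} C_{kl}`, as the function of `i j k l`. -/
def matK (q : ℂ) (N : ℕ) (i j k l : Fin N) : ℂ :=
  metricC q N i j * metricC q N k l

/-- The entry `id^{ij}_{kl}` of the identity of `V ⊗ V`. -/
def matId (N : ℕ) (i j k l : Fin N) : ℂ :=
  if i = k ∧ j = l then 1 else 0

/-- The `R`-matrix `R̂^{ij}_{kl}` of the orthogonal quantum group, as the function of `i j k l`. -/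
def matR (q : ℂ) (N : ℕ) (i j k l : Fin N) : ℂ :=
  q ^ ((if i = j then (2 : ℤ) else 0) - (if i = j.rev then (2 : ℤ) else 0))
      * (if i = l ∧ j = k then 1 else 0)
    + (q ^ 2 - (q ^ 2)⁻¹) * (if i < l then 1 else 0) * (matId N i j k l - matK q N i j k l)

/-- The entry `(P_+)^{ij}_{kl}` of the projection `P_+`, as the function of `i j k l`. -/
def matPplus (q : ℂ) (N : ℕ) (i j k l : Fin N) : ℂ :=
  1 / (q ^ 2 + (q ^ 2)⁻¹) *
    ((q ^ 2)⁻¹ * matId N i j k l + matR q N i j k l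
      - (q + q⁻¹) * (q - q⁻¹) / (q ^ (2 * N) - 1) * matK q N i j k l)

/-- The defining relations of the FRT--Clifford algebra:
`(P_+)^{kl}_{ij} γ_k γ_l = 0` for all `i, j`, and `C^{ij} γ_i γ_j = c² (q^{2N} - 1)/(q² - 1)`. -/
inductive Rel (q c : ℂ) (N : ℕ) : FreeAlgebra ℂ (Fin N) → FreeAlgebra ℂ (Fin N) → Prop
  | plus (i j : Fin N) :
      Rel q c N
        (∑ k : Fin N, ∑ l : Fin N,
          matPplus q N k l i j • (FreeAlgebra.ι ℂ k * FreeAlgebra.ι ℂ l))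
        0
  | metric :
      Rel q c N
        (∑ i : Fin N, ∑ j : Fin N,
          metricC q N i j • (FreeAlgebra.ι ℂ i * FreeAlgebra.ι ℂ j))
        (algebraMap ℂ (FreeAlgebra ℂ (Fin N)) (c ^ 2 * ((q ^ (2 * N) - 1) / (q ^ 2 - 1))))

/-- The FRT--Clifford algebra `Cl_q(N)` with parameter `c`. -/
abbrev Cl (q c : ℂ) (N : ℕ) : Type := RingQuot (Rel q c N)

/-- The generators `γ_i`. -/
def gam (q c : ℂ) (N : ℕ) (i : Fin N) : Cl q c N :=
  RingQuot.mkAlgHom ℂ (Rel q c N) (FreeAlgebra.ι ℂ i)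

/-- The even (`p = 0`) and the odd (`p = 1`) component of `Cl_q(N)` with respect to the
`ℤ/2`-grading in which all `γ_i` are odd: the span of all products of generators whose number of
factors is congruent to `p` modulo `2`. -/
def parityPart (q c : ℂ) (N : ℕ) (p : ZMod 2) : Submodule ℂ (Cl q c N) :=
  Submodule.span ℂ {x | ∃ w : List (Fin N), (w.length : ZMod 2) = p ∧ x = (w.map (gam q c N)).prod}

/-- The product `γ_1^{j_1} γ_2^{j_2} ⋯ γ_n^{j_n}` in `Cl_q(N)`, `n ≤ N`. -/
def lowProd (q c : ℂ) (N n : ℕ) (h : n ≤ N) (J : Fin n → Fin 2) : Cl q c N :=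
  (List.ofFn fun i : Fin n => gam q c N (Fin.castLE h i) ^ (J i : ℕ)).prod

/-- The product `γ_{n'}^{j_n} ⋯ γ_{2'}^{j_2} γ_{1'}^{j_1}` in `Cl_q(N)`, `n ≤ N`. -/
def highProd (q c : ℂ) (N n : ℕ) (h : n ≤ N) (J : Fin n → Fin 2) : Cl q c N :=
  (List.ofFn fun i : Fin n => gam q c N (Fin.castLE h i).rev ^ (J i : ℕ)).reverse.prod

/-- `ℓ(J) = ∑_k j_k`. -/
def ell {n : ℕ} (J : Fin n → Fin 2) : ℕ := ∑ k : Fin n, (J k : ℕ)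

/-- `L(J) = ∑_k k j_k`. -/
def bigL {n : ℕ} (J : Fin n → Fin 2) : ℕ := ∑ k : Fin n, ((k : ℕ) + 1) * (J k : ℕ)

/-- The element `z_0` of `Cl_q(2n)`. -/
def z0 (q c : ℂ) (n : ℕ) : Cl q c (2 * n) :=
  ∑ k ∈ Finset.range (n + 1),
    ((-1) ^ k * ∏ l ∈ Finset.Icc 1 k,
        (q ^ (2 * (l : ℤ) - 2) + q ^ (-2 * (l : ℤ) + 2)) / (q * (q + q⁻¹) * c ^ 2)) •
      ∑ J : Fin n → Fin 2 with ell J = k,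
        q ^ (2 * (bigL J : ℤ) - (k : ℤ) * (2 * (n : ℤ) - k + 1)) •
          (lowProd q c (2 * n) n (by omega) J * highProd q c (2 * n) n (by omega) J)

/-- The element `z_1` of `Cl_q(2n+1)`. -/
def z1 (q c : ℂ) (n : ℕ) : Cl q c (2 * n + 1) :=
  (1 / c) • ∑ k ∈ Finset.range (n + 1),
    (∏ l ∈ Finset.Icc 1 k,
        (q ^ (2 * (l : ℤ) - 1) + q ^ (-2 * (l : ℤ) + 1)) / (q * (q + q⁻¹) * c ^ 2)) •
      ∑ J : Fin n → Fin 2 with ell J = k,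
        q ^ (2 * (bigL J : ℤ) - (k : ℤ) * (2 * (n : ℤ) - k + 1)) •
          (lowProd q c (2 * n + 1) n (by omega) J * gam q c (2 * n + 1) ⟨n, by omega⟩ *
            highProd q c (2 * n + 1) n (by omega) J)

/-- The element `φ = γ_{n+1} γ_{n+2} ⋯ γ_{2n}` of `Cl_q(2n)`. -/
def phiEven (q c : ℂ) (n : ℕ) : Cl q c (2 * n) :=
  (List.ofFn fun t : Fin n => gam q c (2 * n) ⟨n + t, by omega⟩).prod

/-- The element `φ^ν = (ν c + γ_{n+1}) γ_{n+2} γ_{n+3} ⋯ γ_{2n+1}` of `Cl_q(2n+1)`. -/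
def phiOdd (q c : ℂ) (n : ℕ) (ν : ℂ) : Cl q c (2 * n + 1) :=
  (algebraMap ℂ (Cl q c (2 * n + 1)) (ν * c) + gam q c (2 * n + 1) ⟨n, by omega⟩) *
    (List.ofFn fun t : Fin n => gam q c (2 * n + 1) ⟨n + 1 + t, by omega⟩).prod

/-- The left ideal `I_L^ν = Cl_q(2n+1) φ^ν` (in Mathlib, an `Ideal` is a left ideal). -/
def leftIdealOdd (q c : ℂ) (n : ℕ) (ν : ℂ) : Ideal (Cl q c (2 * n + 1)) :=
  Ideal.span {phiOdd q c n ν}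

/-- The subspaces `Cl_q(2n)_p φ`, `p = 0, 1`, of the left ideal `Cl_q(2n) φ`, where `Cl_q(2n)_p` is
the even (`p = 0`) or odd (`p = 1`) component of `Cl_q(2n)`. -/
def spinPart (q c : ℂ) (n : ℕ) (p : ZMod 2) : Submodule ℂ (Cl q c (2 * n)) :=
  (parityPart q c (2 * n) p).map (LinearMap.mulRight ℂ (phiEven q c n))

end

end FRTClifford

namespace FRTClifford

section OrderedProducts

variable {A : Type*} [Ring A]

/-- The ordered product `w_0^{j_0} ⋯ w_{n-1}^{j_{n-1}}`. -/
def ascProd (w : ℕ → A) (n : ℕ) (J : Fin n → Fin 2) : A :=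
  (List.ofFn fun i : Fin n => w i ^ (J i : ℕ)).prod

/-- The ordered product `w_{n-1}^{j_{n-1}} ⋯ w_0^{j_0}`. -/
def descProd (w : ℕ → A) (n : ℕ) (J : Fin n → Fin 2) : A :=
  (List.ofFn fun i : Fin n => w i ^ (J i : ℕ)).reverse.prod

theorem ascProd_snoc (w : ℕ → A) (n : ℕ) (J : Fin n → Fin 2) (t : Fin 2) :
    ascProd w (n + 1) (Fin.snoc J t : Fin (n + 1) → Fin 2) = ascProd w n J * w n ^ (t : ℕ) := by
  simp only [ascProd, List.ofFn_succ', List.concat_eq_append, List.prod_append, List.prod_singleton,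
    Fin.snoc_castSucc, Fin.snoc_last, Fin.val_castSucc, Fin.val_last]

theorem descProd_snoc (w : ℕ → A) (n : ℕ) (J : Fin n → Fin 2) (t : Fin 2) :
    descProd w (n + 1) (Fin.snoc J t : Fin (n + 1) → Fin 2) = w n ^ (t : ℕ) * descProd w n J := by
  simp only [descProd, List.ofFn_succ', List.concat_eq_append, List.reverse_append,
    List.reverse_singleton, List.singleton_append, List.prod_cons, Fin.snoc_castSucc,
    Fin.snoc_last, Fin.val_castSucc, Fin.val_last]

end OrderedProducts

section Ladder

variable {A : Type*} [Ring A] [Algebra ℂ A]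

theorem mul_mul_of_qcomm {y u v : A} {s t : ℂ} (hu : y * u = s • (u * y)) (hv : y * v = t • (v * y)) :
    y * (u * v) = (s * t) • (u * v * y) := by
  rw [← mul_assoc, hu, smul_mul_assoc, mul_assoc, hv, mul_smul_comm, smul_smul, ← mul_assoc]

theorem qcomm_symm {y u : A} {s : ℂ} (hs : s ≠ 0) (h : y * u = s • (u * y)) :
    u * y = s⁻¹ • (y * u) := by
  rw [h, smul_smul, inv_mul_cancel₀ hs, one_smul]

/-- If `y` squares to zero, occurs in `l` and commutes up to scalars with the entries of `l`, then
it annihilates the product of `l`. -/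
theorem mul_list_prod_eq_zero {y : A} (hy : y * y = 0) (l : List A) (hmem : y ∈ l)
    (h : ∀ u ∈ l, ∃ s : ℂ, y * u = s • (u * y)) : y * l.prod = 0 := by
  induction l with
  | nil => simp at hmem
  | cons u t ih =>
    rw [List.prod_cons, ← mul_assoc]
    rcases List.mem_cons.1 hmem with rfl | hm
    · rw [hy, zero_mul]
    · obtain ⟨s, hs⟩ := h u (by simp)
      rw [hs, smul_mul_assoc, mul_assoc, ih hm fun v hv => h v (by simp [hv]), mul_zero, smul_zero]

/-- The interpolation `x ↦ F_n(x)` of the powers of the operator `1 + w_0 + ⋯ + w_{n-1}`. -/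
noncomputable def interp (p : ℂ) (w : ℕ → A) : ℕ → ℂ → A
  | 0, _ => 1
  | n + 1, x => interp p w n x + ((x - 1) / (p - 1)) • (interp p w n (x / p) * w n)

variable {p : ℂ} {w : ℕ → A}

theorem interp_one (n : ℕ) : interp p w n 1 = 1 := by
  induction n with
  | zero => rfl
  | succ n ih => simp [interp, ih]

theorem interp_self (hp : p ≠ 0) (hp1 : p - 1 ≠ 0) (n : ℕ) :
    interp p w n p = 1 + ∑ k ∈ Finset.range n, w k := by
  induction n with
  | zero => simp [interp]
  | succ n ih =>
    rw [interp, ih, div_self hp1, div_self hp, interp_one, Finset.sum_range_succ, one_smul, one_mul,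
      add_assoc]

theorem commute_interp {y : A} (n : ℕ) (h : ∀ i < n, Commute y (w i)) (x : ℂ) :
    Commute y (interp p w n x) := by
  induction n generalizing x with
  | zero => exact Commute.one_right y
  | succ n ih =>
    have h' : ∀ i < n, Commute y (w i) := fun i hi => h i (by omega)
    exact (ih h' x).add_right (((ih h' _).mul_right (h n (by omega))).smul_right _)

theorem interp_mul_interp (hp : p ≠ 0) (hp1 : p - 1 ≠ 0) (n : ℕ)
    (hw : ∀ i < n, w i * w i = (p - 1) • (interp p w i p * w i))
    (hc : ∀ i < n, ∀ j < i, Commute (w i) (w j)) (x y : ℂ) :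
    interp p w n x * interp p w n y = interp p w n (x * y) := by
  induction n generalizing x y with
  | zero => simp [interp]
  | succ n ih =>
    have ih := fun x y => ih (fun i hi => hw i (by omega)) (fun i hi => hc i (by omega)) x y
    have hcn : ∀ y, w n * interp p w n y = interp p w n y * w n := fun y =>
      commute_interp n (fun j hj => hc n (by omega) j hj) y
    have e1 : interp p w n x * (interp p w n (y / p) * w n) = interp p w n (x * y / p) * w n := by
      rw [← mul_assoc, ih, mul_div_assoc]
    have e2 : interp p w n (x / p) * w n * interp p w n y = interp p w n (x * y / p) * w n := by
      rw [mul_assoc, hcn, ← mul_assoc, ih, div_mul_eq_mul_div]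
    have e3 : interp p w n (x / p) * w n * (interp p w n (y / p) * w n) =
        (p - 1) • (interp p w n (x * y / p) * w n) := by
      rw [mul_assoc, ← mul_assoc (w n), hcn, mul_assoc, hw n (by omega), mul_smul_comm,
        mul_smul_comm, ← mul_assoc, ← mul_assoc, ih, ih]
      congr 3
      field_simp
    simp only [interp, mul_add, add_mul, mul_smul_comm, smul_mul_assoc, e1, e2, e3, ih]
    match_scalars <;> field_simp
    ring

theorem interp_mul_eq_self {φ : A} (n : ℕ) (h : ∀ i < n, w i * φ = 0) (x : ℂ) :
    interp p w n x * φ = φ := by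
  induction n generalizing x with
  | zero => simp [interp]
  | succ n ih =>
    rw [interp, add_mul, ih (fun i hi => h i (by omega)), smul_mul_assoc, mul_assoc,
      h n (by omega), mul_zero, smul_zero, add_zero]

theorem interp_succ_mul_of_qcomm {y : A} {n : ℕ} (hp : p ≠ 0)
    (h : ∀ x, interp p w n x * y = x • (y * interp p w n x)) (hw : w n * y = p • (y * w n)) (x : ℂ) :
    interp p w (n + 1) x * y = x • (y * interp p w (n + 1) x) := by
  rw [interp, add_mul, h, smul_mul_assoc, mul_assoc, hw, mul_smul_comm, ← mul_assoc, h, mul_add,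
    mul_smul_comm, smul_mul_assoc, smul_add, smul_smul, smul_smul, smul_smul, ← mul_assoc y]
  congr 2
  field_simp

theorem mul_interp_succ_of_qcomm {y : A} {n : ℕ} (hp : p ≠ 0)
    (h : ∀ x, y * interp p w n x = x • (interp p w n x * y)) (hw : y * w n = p • (w n * y)) (x : ℂ) :
    y * interp p w (n + 1) x = x • (interp p w (n + 1) x * y) := by
  rw [interp, mul_add, h, mul_smul_comm, ← mul_assoc, h, smul_mul_assoc, mul_assoc, hw,
    mul_smul_comm, add_mul, smul_mul_assoc, smul_add, smul_smul, smul_smul, smul_smul, ← mul_assoc]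
  congr 2
  field_simp

theorem interp_succ_mul_raising {y : A} {n : ℕ} (hp : p ≠ 0) (hp1 : p - 1 ≠ 0)
    (hc : ∀ x, Commute y (interp p w n x)) (hw : w n * y = (p - 1) • (y * interp p w n p))
    (hw' : y * w n = 0) (hm : ∀ x x', interp p w n x * interp p w n x' = interp p w n (x * x'))
    (x : ℂ) : interp p w (n + 1) x * y = x • (y * interp p w (n + 1) x) := by
  have e1 : interp p w n (x / p) * w n * y = (p - 1) • (y * interp p w n x) := by
    rw [mul_assoc, hw, mul_smul_comm, ← mul_assoc, ← (hc _).eq, mul_assoc, hm, div_mul_cancel₀ _ hp]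
  have e2 : y * (interp p w n (x / p) * w n) = 0 := by
    rw [← mul_assoc, (hc _).eq, mul_assoc, hw', mul_zero]
  rw [interp, add_mul, mul_add, smul_mul_assoc, mul_smul_comm, e1, e2, (hc x).eq, smul_smul,
    div_mul_cancel₀ _ hp1, smul_zero, add_zero, sub_smul, one_smul]
  abel

theorem mul_interp_succ_lowering {y : A} {n : ℕ} (hp : p ≠ 0) (hp1 : p - 1 ≠ 0)
    (hc : ∀ x, Commute y (interp p w n x)) (hw : y * w n = (p - 1) • (interp p w n p * y))
    (hw' : w n * y = 0) (hm : ∀ x x', interp p w n x * interp p w n x' = interp p w n (x * x'))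
    (x : ℂ) : y * interp p w (n + 1) x = x • (interp p w (n + 1) x * y) := by
  have e1 : y * (interp p w n (x / p) * w n) = (p - 1) • (interp p w n x * y) := by
    rw [← mul_assoc, (hc _).eq, mul_assoc, hw, mul_smul_comm, ← mul_assoc, hm, div_mul_cancel₀ _ hp]
  have e2 : interp p w n (x / p) * w n * y = 0 := by
    rw [mul_assoc, hw', mul_zero]
  rw [interp, mul_add, add_mul, smul_mul_assoc, mul_smul_comm, e1, e2, (hc x).eq, smul_smul,
    div_mul_cancel₀ _ hp1, smul_zero, add_zero, sub_smul, one_smul]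
  abel

/-- The coefficient of the `k`-th elementary symmetric function of the `w_i` in `interp`. -/
noncomputable def interpCoeff (p x : ℂ) (k : ℕ) : ℂ :=
  ∏ l ∈ Finset.range k, (x / p ^ l - 1) / (p - 1)

theorem interpCoeff_succ (p x : ℂ) (k : ℕ) :
    interpCoeff p x (k + 1) = (x - 1) / (p - 1) * interpCoeff p (x / p) k := by
  rw [interpCoeff, Finset.prod_range_succ', mul_comm]
  congr 1
  · simp
  · refine Finset.prod_congr rfl fun l _ => ?_
    rw [pow_succ', div_div]

theorem sum_snoc {M : Type*} [AddCommMonoid M] {n : ℕ} (f : (Fin (n + 1) → Fin 2) → M) :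
    ∑ J, f J = ∑ J : Fin n → Fin 2, (f (Fin.snoc J 0) + f (Fin.snoc J 1)) := by
  rw [← (Fin.snocEquiv fun _ : Fin (n + 1) => Fin 2).sum_comp, Fintype.sum_prod_type_right]
  refine Finset.sum_congr rfl fun J _ => ?_
  rw [Fin.sum_univ_two]
  rfl

theorem ell_snoc {n : ℕ} (J : Fin n → Fin 2) (t : Fin 2) :
    ell (Fin.snoc J t : Fin (n + 1) → Fin 2) = ell J + t := by
  simp [ell, Fin.sum_univ_castSucc]

theorem bigL_snoc {n : ℕ} (J : Fin n → Fin 2) (t : Fin 2) :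
    bigL (Fin.snoc J t : Fin (n + 1) → Fin 2) = bigL J + (n + 1) * t := by
  simp [bigL, Fin.sum_univ_castSucc]

theorem interp_eq_sum (n : ℕ) (x : ℂ) :
    interp p w n x = ∑ J : Fin n → Fin 2, interpCoeff p x (ell J) • ascProd w n J := by
  induction n generalizing x with
  | zero => simp [interp, ell, interpCoeff, ascProd]
  | succ n ih =>
    rw [sum_snoc, Finset.sum_add_distrib, interp, ih, ih]
    congr 1
    · refine Finset.sum_congr rfl fun J _ => ?_
      rw [ell_snoc, ascProd_snoc]
      simp
    · rw [Finset.sum_mul, Finset.smul_sum]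
      refine Finset.sum_congr rfl fun J _ => ?_
      rw [ell_snoc, ascProd_snoc, Fin.val_one, interpCoeff_succ, pow_one, smul_mul_assoc, smul_smul]

theorem mul_descProd {y : A} {b : ℕ → A} {s : ℂ} (n : ℕ) (h : ∀ i < n, y * b i = s • (b i * y))
    (J : Fin n → Fin 2) : y * descProd b n J = s ^ ell J • (descProd b n J * y) := by
  induction n with
  | zero => simp [descProd, ell]
  | succ n ih =>
    have ih := ih (fun i hi => h i (by omega)) (Fin.init J)
    rw [← Fin.snoc_init_self J, descProd_snoc, ell_snoc]
    generalize J (Fin.last n) = t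
    fin_cases t
    · simpa using ih
    · simpa [pow_succ'] using mul_mul_of_qcomm (h n (by omega)) ih

/-- `n` pairs of generators `a_i`, `b_i` satisfying the relations of `γ_i`, `γ_{i'}` in the
FRT--Clifford algebra. -/
structure IsPairs (q : ℂ) (n : ℕ) (μ : ℕ → ℂ) (a b : ℕ → A) : Prop where
  a_sq : ∀ i < n, a i * a i = 0
  b_sq : ∀ i < n, b i * b i = 0
  aa : ∀ i j, i < j → j < n → a j * a i = (-q ^ 2) • (a i * a j)
  bb : ∀ i j, i < j → j < n → b i * b j = (-q ^ 2) • (b j * b i)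
  ba : ∀ i j, i ≠ j → i < n → j < n → b i * a j = (-q ^ 2) • (a j * b i)
  ab_add_ba : ∀ i < n, μ i • (a i * b i + b i * a i) =
    (q ^ 4 - 1) • (1 + ∑ k ∈ Finset.range i, μ k • (a k * b k))

namespace IsPairs

variable {q : ℂ} {n : ℕ} {μ : ℕ → ℂ} {a b : ℕ → A}

theorem commute_a (h : IsPairs q n μ a b) (hq : q ≠ 0) {i j : ℕ} (hij : i < j) (hj : j < n) :
    Commute (a j) (μ i • (a i * b i)) := by
  refine Commute.smul_right ?_ _
  have := mul_mul_of_qcomm (h.aa i j hij hj)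
    (qcomm_symm (by simpa using hq) (h.ba i j (by omega) (by omega) hj))
  rwa [mul_inv_cancel₀ (by simpa using hq), one_smul] at this

theorem commute_b (h : IsPairs q n μ a b) (hq : q ≠ 0) {i j : ℕ} (hij : i < j) (hj : j < n) :
    Commute (b j) (μ i • (a i * b i)) := by
  refine Commute.smul_right ?_ _
  have := mul_mul_of_qcomm (h.ba j i (by omega) hj (by omega))
    (qcomm_symm (by simpa using hq) (h.bb i j hij hj))
  rwa [mul_inv_cancel₀ (by simpa using hq), one_smul] at this

theorem w_mul_a_of_lt (h : IsPairs q n μ a b) (hq : q ≠ 0) {i j : ℕ} (hij : i < j) (hj : j < n) :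
    μ j • (a j * b j) * a i = q ^ 4 • (a i * μ j • (a j * b j)) := by
  have hq2 : -q ^ 2 ≠ 0 := by simpa using hq
  have := mul_mul_of_qcomm (qcomm_symm hq2 (h.aa i j hij hj))
    (qcomm_symm hq2 (h.ba j i (by omega) (by omega) (by omega)))
  rw [mul_smul_comm, this, smul_mul_assoc, smul_smul, smul_smul]
  congr 1
  field_simp

theorem b_mul_w_of_lt (h : IsPairs q n μ a b) {i j : ℕ} (hij : i < j) (hj : j < n) :
    b i * (a j * b j) = q ^ 4 • (a j * b j * b i) := by
  rw [mul_mul_of_qcomm (h.ba i j (by omega) (by omega) hj) (h.bb i j hij hj)]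
  congr 1
  ring

theorem commute_w (h : IsPairs q n μ a b) (hq : q ≠ 0) {i j : ℕ} (hij : i < j) (hj : j < n) :
    Commute (μ j • (a j * b j)) (μ i • (a i * b i)) :=
  ((h.commute_a hq hij hj).mul_left (h.commute_b hq hij hj)).smul_left _

theorem interp_self (hq : q ≠ 0) (hq4 : q ^ 4 - 1 ≠ 0) (i : ℕ) :
    interp (q ^ 4) (fun i => μ i • (a i * b i)) i (q ^ 4) =
      1 + ∑ k ∈ Finset.range i, μ k • (a k * b k) :=
  FRTClifford.interp_self (pow_ne_zero 4 hq) hq4 i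

theorem w_mul_a (h : IsPairs q n μ a b) (hq : q ≠ 0) (hq4 : q ^ 4 - 1 ≠ 0) {i : ℕ} (hi : i < n) :
    μ i • (a i * b i) * a i =
      (q ^ 4 - 1) • (a i * interp (q ^ 4) (fun i => μ i • (a i * b i)) i (q ^ 4)) := by
  rw [interp_self hq hq4, ← mul_smul_comm (q ^ 4 - 1), ← h.ab_add_ba i hi, mul_smul_comm, mul_add,
    ← mul_assoc, h.a_sq i hi, zero_mul, zero_add, smul_mul_assoc, mul_assoc]

theorem b_mul_w (h : IsPairs q n μ a b) (hq : q ≠ 0) (hq4 : q ^ 4 - 1 ≠ 0) {i : ℕ} (hi : i < n) :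
    b i * μ i • (a i * b i) =
      (q ^ 4 - 1) • (interp (q ^ 4) (fun i => μ i • (a i * b i)) i (q ^ 4) * b i) := by
  rw [interp_self hq hq4, ← smul_mul_assoc (q ^ 4 - 1), ← h.ab_add_ba i hi, mul_smul_comm, smul_mul_assoc,
    add_mul, mul_assoc, h.b_sq i hi, mul_zero, zero_add, mul_assoc]

theorem w_mul_w (h : IsPairs q n μ a b) (hq : q ≠ 0) (hq4 : q ^ 4 - 1 ≠ 0) {i : ℕ} (hi : i < n) :
    μ i • (a i * b i) * μ i • (a i * b i) =
      (q ^ 4 - 1) • (interp (q ^ 4) (fun i => μ i • (a i * b i)) i (q ^ 4) * μ i • (a i * b i)) := by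
  have hc := commute_interp (p := q ^ 4) i (fun k hk => h.commute_a hq hk hi) (q ^ 4)
  rw [mul_smul_comm, ← mul_assoc, h.w_mul_a hq hq4 hi, hc.eq, smul_mul_assoc, smul_comm, mul_assoc,
    mul_smul_comm]

theorem interp_mul_interp (h : IsPairs q n μ a b) (hq : q ≠ 0) (hq4 : q ^ 4 - 1 ≠ 0) (x y : ℂ) :
    interp (q ^ 4) (fun i => μ i • (a i * b i)) n x *
        interp (q ^ 4) (fun i => μ i • (a i * b i)) n y =
      interp (q ^ 4) (fun i => μ i • (a i * b i)) n (x * y) :=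
  FRTClifford.interp_mul_interp (pow_ne_zero 4 hq) hq4 n (fun _ hi => h.w_mul_w hq hq4 hi)
    (fun _ hi _ hj => h.commute_w hq hj hi) x y

theorem mono (h : IsPairs q n μ a b) {m : ℕ} (hm : m ≤ n) : IsPairs q m μ a b where
  a_sq i hi := h.a_sq i (by omega)
  b_sq i hi := h.b_sq i (by omega)
  aa i j hij hj := h.aa i j hij (by omega)
  bb i j hij hj := h.bb i j hij (by omega)
  ba i j hij hi hj := h.ba i j hij (by omega) (by omega)
  ab_add_ba i hi := h.ab_add_ba i (by omega)

theorem interp_mul_a (h : IsPairs q n μ a b) (hq : q ≠ 0) (hq4 : q ^ 4 - 1 ≠ 0) {i : ℕ}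
    (hi : i < n) (x : ℂ) :
    interp (q ^ 4) (fun i => μ i • (a i * b i)) n x * a i =
      x • (a i * interp (q ^ 4) (fun i => μ i • (a i * b i)) n x) := by
  induction n generalizing x with
  | zero => omega
  | succ n ih =>
    have hn := h.mono (Nat.le_succ n)
    rcases Nat.lt_succ_iff_lt_or_eq.1 hi with hi | rfl
    · exact interp_succ_mul_of_qcomm (pow_ne_zero 4 hq) (ih hn hi)
        (h.w_mul_a_of_lt hq hi (Nat.lt_succ_self n)) x
    · refine interp_succ_mul_raising (pow_ne_zero 4 hq) hq4
        (fun x => commute_interp i (fun k hk => h.commute_a hq hk (Nat.lt_succ_self i)) x)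
        (h.w_mul_a hq hq4 (Nat.lt_succ_self i)) ?_ (hn.interp_mul_interp hq hq4) x
      rw [mul_smul_comm, ← mul_assoc, h.a_sq i (by omega), zero_mul, smul_zero]

theorem b_mul_interp (h : IsPairs q n μ a b) (hq : q ≠ 0) (hq4 : q ^ 4 - 1 ≠ 0) {i : ℕ}
    (hi : i < n) (x : ℂ) :
    b i * interp (q ^ 4) (fun i => μ i • (a i * b i)) n x =
      x • (interp (q ^ 4) (fun i => μ i • (a i * b i)) n x * b i) := by
  induction n generalizing x with
  | zero => omega
  | succ n ih =>
    have hn := h.mono (Nat.le_succ n)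
    rcases Nat.lt_succ_iff_lt_or_eq.1 hi with hi | rfl
    · refine mul_interp_succ_of_qcomm (pow_ne_zero 4 hq) (ih hn hi) ?_ x
      rw [mul_smul_comm, h.b_mul_w_of_lt hi (Nat.lt_succ_self n), smul_comm, smul_mul_assoc]
    · refine mul_interp_succ_lowering (pow_ne_zero 4 hq) hq4
        (fun x => commute_interp i (fun k hk => h.commute_b hq hk (Nat.lt_succ_self i)) x)
        (h.b_mul_w hq hq4 (Nat.lt_succ_self i)) ?_ (hn.interp_mul_interp hq hq4) x
      rw [smul_mul_assoc, mul_assoc, h.b_sq i (by omega), mul_zero, smul_zero]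

/-- The nested product `a_J b_J` as a multiple of the product of the `w_i`. -/
theorem ascProd_mul_descProd (h : IsPairs q n μ a b) (hq : q ≠ 0) {κ : ℂ} (N : ℤ) (hκ : κ ≠ 0)
    (hμ : ∀ i < n, μ i = κ * q ^ (2 * ((i : ℤ) + 1) - N)) (J : Fin n → Fin 2) :
    ascProd a n J * descProd b n J =
      (κ⁻¹ ^ ell J * q ^ (N * ell J - 2 * bigL J - 2 * ell J * (ell J - 1) : ℤ)) •
        ascProd (fun i => μ i • (a i * b i)) n J := by
  induction n with
  | zero => simp [ascProd, descProd, ell, bigL]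
  | succ n ih =>
    have ih := ih (h.mono (Nat.le_succ n)) (fun i hi => hμ i (by omega)) (Fin.init J)
    rw [← Fin.snoc_init_self J, ascProd_snoc, descProd_snoc, ascProd_snoc, ell_snoc, bigL_snoc]
    generalize J (Fin.last n) = t
    generalize Fin.init J = I at *
    fin_cases t
    · simpa using ih
    · have hq4 : q ^ 4 ≠ 0 := pow_ne_zero 4 hq
      have key := mul_descProd n
        (fun i hi => qcomm_symm hq4 (h.b_mul_w_of_lt hi (Nat.lt_succ_self n))) I
      simp only [pow_one, mul_one]
      rw [mul_assoc, ← mul_assoc (a n), key, mul_smul_comm, ← mul_assoc, ih, smul_mul_assoc,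
        mul_smul_comm, smul_smul, smul_smul, hμ n (by omega)]
      congr 1
      push_cast
      rw [inv_pow, ← pow_mul, ← zpow_natCast, ← zpow_neg, pow_succ κ⁻¹]
      have e : q ^ (N * (ell I + 1) - 2 * (bigL I + (n + 1)) -
            2 * (ell I + 1) * (ell I + 1 - 1) : ℤ) * q ^ (2 * ((n : ℤ) + 1) - N) =
          q ^ (-((4 * ell I : ℕ) : ℤ)) *
            q ^ (N * ell I - 2 * bigL I - 2 * ell I * (ell I - 1) : ℤ) := by
        rw [← zpow_add₀ hq, ← zpow_add₀ hq]
        congr 1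
        push_cast
        ring
      linear_combination (-κ⁻¹ ^ ell I) * e - κ⁻¹ ^ ell I *
        (q ^ (N * (ell I + 1) - 2 * (bigL I + (n + 1)) - 2 * (ell I + 1) * (ell I + 1 - 1) : ℤ) *
          q ^ (2 * ((n : ℤ) + 1) - N)) * inv_mul_cancel₀ hκ

end IsPairs

end Ladder

end FRTClifford

namespace FRTClifford

section Relations

variable (q c : ℂ) (N : ℕ)

theorem sum_metric :
    ∑ k : Fin N, metricC q N k k.rev • (gam q c N k * gam q c N k.rev) =
      algebraMap ℂ (Cl q c N) (c ^ 2 * ((q ^ (2 * N) - 1) / (q ^ 2 - 1))) := by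
  have h := RingQuot.mkAlgHom_rel ℂ (Rel.metric (q := q) (c := c) (N := N))
  rw [AlgHom.commutes] at h
  rw [← h, map_sum]
  refine Finset.sum_congr rfl fun k _ => ?_
  rw [map_sum, Finset.sum_eq_single k.rev]
  · rw [map_smul, map_mul]
    rfl
  · intro l _ hl
    rw [metricC, if_neg, zero_smul, map_zero]
    rintro rfl
    exact hl (Fin.rev_rev l).symm
  · simp

/-- The quadratic relations, with `C^{kl} γ_k γ_l` replaced by its value. -/
theorem quadratic_relation (hq0 : q ≠ 0) (hq : ∀ m : ℕ, 0 < m → q ^ m ≠ 1) (hN : 0 < N) (i j : Fin N) :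
    (q ^ 2)⁻¹ • (gam q c N i * gam q c N j) +
      q ^ ((if j = i then (2 : ℤ) else 0) - (if j = i.rev then (2 : ℤ) else 0)) •
        (gam q c N j * gam q c N i) +
      (q ^ 2 - (q ^ 2)⁻¹) • ((if i < j then gam q c N i * gam q c N j else 0) -
        metricC q N i j • (∑ k : Fin N with k < j,
            metricC q N k k.rev • (gam q c N k * gam q c N k.rev) +
          algebraMap ℂ (Cl q c N) (c ^ 2 / (q ^ 2 - 1)))) = 0 := by
  have h := RingQuot.mkAlgHom_rel ℂ (Rel.plus (q := q) (c := c) i j)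
  simp only [map_sum, map_smul, map_mul, map_zero] at h
  change ∑ k, ∑ l, matPplus q N k l i j • (gam q c N k * gam q c N l) = 0 at h
  have h2 : q ^ 2 + (q ^ 2)⁻¹ ≠ 0 := by
    intro h0
    have h4 : q ^ 4 = -1 := by
      field_simp at h0
      linear_combination h0
    exact hq 8 (by norm_num) (by linear_combination (q ^ 4 - 1) * h4)
  have hN1 : q ^ (2 * N) - 1 ≠ 0 := sub_ne_zero.2 (hq _ (by omega))
  have hq2 : q ^ 2 - 1 ≠ 0 := sub_ne_zero.2 (hq 2 (by omega))
  have hT := sum_metric q c N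
  have eK : ∀ (P : Fin N → Prop) [DecidablePred P],
      ∑ k : Fin N, ∑ l : Fin N, (if P k then matK q N k l i j else 0) • (gam q c N k * gam q c N l) =
        metricC q N i j • ∑ k : Fin N with P k,
          metricC q N k k.rev • (gam q c N k * gam q c N k.rev) := by
    intro P _
    rw [Finset.smul_sum, Finset.sum_filter]
    refine Finset.sum_congr rfl fun k _ => ?_
    rw [Finset.sum_eq_single k.rev]
    · split_ifs
      · rw [matK, mul_comm, mul_smul]
      · rw [zero_smul]
    · intro l _ hl
      have : metricC q N k l = 0 := by
        rw [metricC, if_neg]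
        rintro rfl
        exact hl (Fin.rev_rev l).symm
      simp [matK, this]
    · simp
  have eI : ∑ k : Fin N, ∑ l : Fin N, matId N k l i j • (gam q c N k * gam q c N l) =
      gam q c N i * gam q c N j := by
    simp [matId, ite_and, ite_smul, Finset.sum_ite_eq']
  have eS : ∑ k : Fin N, ∑ l : Fin N,
      (q ^ ((if k = l then (2 : ℤ) else 0) - (if k = l.rev then (2 : ℤ) else 0)) *
        (if k = j ∧ l = i then (1 : ℂ) else 0)) • (gam q c N k * gam q c N l) =
      q ^ ((if j = i then (2 : ℤ) else 0) - (if j = i.rev then (2 : ℤ) else 0)) •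
        (gam q c N j * gam q c N i) := by
    rw [Finset.sum_eq_single j, Finset.sum_eq_single i]
    · simp
    · intro l _ hl
      simp [hl]
    · simp
    · intro k _ hk
      simp [hk]
    · simp
  have eJ : ∑ k : Fin N, ∑ l : Fin N,
      ((if k < j then (1 : ℂ) else 0) * matId N k l i j) • (gam q c N k * gam q c N l) =
      if i < j then gam q c N i * gam q c N j else 0 := by
    rw [Finset.sum_eq_single i, Finset.sum_eq_single j]
    · simp [matId, ite_smul]
    · intro l _ hl
      simp [matId, hl]
    · simp
    · intro k _ hk
      simp [matId, hk]
    · simp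
  have eK1 := eK fun k => k < j
  have eK2 := eK fun _ => True
  simp only [if_true, Finset.filter_true] at eK2
  rw [hT] at eK2
  have hexp : ∀ k l, matPplus q N k l i j • (gam q c N k * gam q c N l) =
      (1 / (q ^ 2 + (q ^ 2)⁻¹)) • ((q ^ 2)⁻¹ • (matId N k l i j • (gam q c N k * gam q c N l)) +
        (q ^ ((if k = l then (2 : ℤ) else 0) - (if k = l.rev then (2 : ℤ) else 0)) *
          (if k = j ∧ l = i then (1 : ℂ) else 0)) • (gam q c N k * gam q c N l) +
        (q ^ 2 - (q ^ 2)⁻¹) •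
          (((if k < j then (1 : ℂ) else 0) * matId N k l i j) • (gam q c N k * gam q c N l) -
            (if k < j then matK q N k l i j else 0) • (gam q c N k * gam q c N l)) -
        ((q + q⁻¹) * (q - q⁻¹) / (q ^ (2 * N) - 1)) •
          (matK q N k l i j • (gam q c N k * gam q c N l))) := by
    intro k l
    have hite : (if k < j then matK q N k l i j else 0) =
        (if k < j then (1 : ℂ) else 0) * matK q N k l i j := by simp
    rw [hite, matPplus, matR]
    module
  simp only [hexp, ← Finset.smul_sum, Finset.sum_add_distrib, Finset.sum_sub_distrib, eI, eS, eJ,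
    eK1, eK2] at h
  rw [smul_eq_zero_iff_right (one_div_ne_zero h2)] at h
  have hs : ((q + q⁻¹) * (q - q⁻¹) / (q ^ (2 * N) - 1)) • metricC q N i j •
      algebraMap ℂ (Cl q c N) (c ^ 2 * ((q ^ (2 * N) - 1) / (q ^ 2 - 1))) =
      (q ^ 2 - (q ^ 2)⁻¹) • metricC q N i j • algebraMap ℂ (Cl q c N) (c ^ 2 / (q ^ 2 - 1)) := by
    simp only [Algebra.algebraMap_eq_smul_one, smul_smul]
    congr 1
    field_simp
    ring
  rw [hs] at h
  refine Eq.trans ?_ h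
  rw [smul_add, ← sub_sub, smul_sub _ (_ - _)]
  abel

variable {q c N}

theorem metricC_rev_of_lt {k : Fin N} (hk : k < k.rev) :
    metricC q N k k.rev = q ^ (2 * ((k : ℤ) + 1) - N) := by
  rw [metricC, if_pos (Fin.rev_rev k).symm, twoRho, if_pos hk, if_neg (not_lt.2 hk.le)]
  congr 1
  ring

theorem metricC_rev_left_of_lt {k : Fin N} (hk : k < k.rev) :
    metricC q N k.rev k = q ^ ((N : ℤ) - 2 * ((k : ℤ) + 1)) := by
  rw [metricC, if_pos rfl, twoRho, Fin.rev_rev, if_neg (not_lt.2 hk.le), if_pos hk]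
  congr 1
  ring

theorem metricC_of_ne {i j : Fin N} (h : j ≠ i.rev) : metricC q N i j = 0 := by
  rw [metricC, if_neg]
  rintro rfl
  exact h (Fin.rev_rev j).symm

variable (c)

theorem gam_mul_self (hq0 : q ≠ 0) (hq : ∀ m : ℕ, 0 < m → q ^ m ≠ 1) {i : Fin N} (hi : i ≠ i.rev) :
    gam q c N i * gam q c N i = 0 := by
  have h := quadratic_relation q c N hq0 hq i.pos i i
  have h4 : (q ^ 2)⁻¹ + q ^ 2 ≠ 0 := by
    intro h0
    have h4 : q ^ 4 = -1 := by
      field_simp at h0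
      linear_combination h0
    exact hq 8 (by norm_num) (by linear_combination (q ^ 4 - 1) * h4)
  rw [metricC_of_ne hi, if_pos rfl, if_neg hi, if_neg (lt_irrefl i), zero_smul, sub_zero, sub_zero,
    smul_zero, add_zero, ← add_smul, smul_eq_zero] at h
  exact h.resolve_left (by exact_mod_cast h4)

theorem gam_mul_gam_of_lt (hq0 : q ≠ 0) (hq : ∀ m : ℕ, 0 < m → q ^ m ≠ 1) {i j : Fin N}
    (hij : i < j) (hj : j ≠ i.rev) :
    gam q c N j * gam q c N i = (-q ^ 2) • (gam q c N i * gam q c N j) := by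
  have h := quadratic_relation q c N hq0 hq i.pos i j
  rw [metricC_of_ne hj, if_pos hij, if_neg hij.ne', if_neg hj, zero_smul, sub_zero, sub_zero,
    zpow_zero, one_smul] at h
  rw [← sub_eq_zero, ← h]
  module

end Relations

section Pairs

variable {q c : ℂ} {N : ℕ}

/-- The `k`-th generator, counting from zero and with value zero outside of the range. -/
noncomputable def gamNat (q c : ℂ) (N k : ℕ) : Cl q c N :=
  if h : k < N then gam q c N ⟨k, h⟩ else 0

theorem gamNat_of_lt {k : ℕ} (h : k < N) : gamNat q c N k = gam q c N ⟨k, h⟩ := dif_pos h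

theorem gamNat_rev {k : ℕ} (h : k < N) :
    gamNat q c N (N - 1 - k) = gam q c N (Fin.rev ⟨k, h⟩) := by
  rw [gamNat_of_lt (by omega)]
  congr 1
  ext
  simp only [Fin.val_rev]
  omega

/-- The scalar `μ_k` for which `w_k = μ_k γ_k γ_{k'}`. -/
noncomputable def pairScalar (q c : ℂ) (N k : ℕ) : ℂ :=
  (q ^ 2 - 1) / c ^ 2 * q ^ (2 * ((k : ℤ) + 1) - N)

theorem sum_filter_lt_fin {M : Type*} [AddCommMonoid M] (f : ℕ → M) {j : ℕ} (hj : j ≤ N) :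
    ∑ k : Fin N with k.val < j, f k = ∑ k ∈ Finset.range j, f k := by
  rw [Finset.sum_filter, Fin.sum_univ_eq_sum_range (fun k => if k < j then f k else 0) N,
    ← Finset.sum_filter]
  congr 1
  ext k
  simp
  omega

/-- The partial metric sum in terms of `1 + w_0 + ⋯ + w_{j-1}`. -/
theorem partial_metric (hq : q ^ 2 - 1 ≠ 0) (hc : c ≠ 0) {j : Fin N} (hj : 2 * j.val ≤ N) :
    ∑ k : Fin N with k < j, metricC q N k k.rev • (gam q c N k * gam q c N k.rev) +
        algebraMap ℂ (Cl q c N) (c ^ 2 / (q ^ 2 - 1)) =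
      (c ^ 2 / (q ^ 2 - 1)) • (1 + ∑ k ∈ Finset.range j,
        pairScalar q c N k • (gamNat q c N k * gamNat q c N (N - 1 - k))) := by
  rw [← sum_filter_lt_fin _ j.isLt.le, smul_add, add_comm, Algebra.algebraMap_eq_smul_one,
    Finset.smul_sum]
  congr 1
  refine Finset.sum_congr (by ext; simp) fun k hk => ?_
  have hk : k.val < j.val := by simpa using hk
  have hkr : k < k.rev := by
    rw [Fin.lt_def, Fin.val_rev]
    omega
  rw [gamNat_of_lt k.isLt, gamNat_rev k.isLt, metricC_rev_of_lt hkr, smul_smul, pairScalar]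
  congr 1
  field_simp

theorem gam_pair (hq0 : q ≠ 0) (hq : ∀ m : ℕ, 0 < m → q ^ m ≠ 1) (hc : c ≠ 0) {j : Fin N}
    (hj : j < j.rev) :
    pairScalar q c N j • (gam q c N j * gam q c N j.rev + gam q c N j.rev * gam q c N j) =
      (q ^ 4 - 1) • (1 + ∑ k ∈ Finset.range j,
        pairScalar q c N k • (gamNat q c N k * gamNat q c N (N - 1 - k))) := by
  have hq2 : q ^ 2 - 1 ≠ 0 := sub_ne_zero.2 (hq 2 (by omega))
  have h := quadratic_relation q c N hq0 hq j.pos j.rev j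
  have hj2 : 2 * j.val ≤ N := by
    rw [Fin.lt_def, Fin.val_rev] at hj
    omega
  rw [Fin.rev_rev, if_pos rfl, if_neg hj.ne, if_neg (not_lt.2 hj.le), zero_sub, zero_sub,
    partial_metric hq2 hc hj2, metricC_rev_left_of_lt hj] at h
  generalize 1 + ∑ k ∈ Finset.range j,
    pairScalar q c N k • (gamNat q c N k * gamNat q c N (N - 1 - k)) = S at *
  have h' : gam q c N j * gam q c N j.rev + gam q c N j.rev * gam q c N j =
      (q ^ 2 * ((q ^ 2 - (q ^ 2)⁻¹) * (q ^ ((N : ℤ) - 2 * ((j : ℤ) + 1)) *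
        (c ^ 2 / (q ^ 2 - 1))))) • S := by
    have h2 : q ^ (-2 : ℤ) = (q ^ 2)⁻¹ := by
      rw [zpow_neg]
      norm_cast
    rw [h2] at h
    have := congrArg (fun x => q ^ 2 • x) h
    simp only [smul_add, smul_neg, smul_smul, mul_inv_cancel₀ (pow_ne_zero 2 hq0), one_smul,
      smul_zero] at this
    rw [add_comm, ← sub_eq_zero, sub_eq_add_neg, this]
  rw [h', smul_smul, pairScalar]
  congr 1
  have hz : q ^ (2 * ((j : ℤ) + 1) - N) * q ^ ((N : ℤ) - 2 * ((j : ℤ) + 1)) = 1 := by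
    rw [← zpow_add₀ hq0]
    simp
  have : q ^ 2 * (q ^ 2 - (q ^ 2)⁻¹) = q ^ 4 - 1 := by
    field_simp
  calc _ = q ^ 2 * (q ^ 2 - (q ^ 2)⁻¹) * (q ^ (2 * ((j : ℤ) + 1) - N) *
        q ^ ((N : ℤ) - 2 * ((j : ℤ) + 1))) := by
        field_simp
    _ = _ := by rw [hz, this, mul_one]

theorem gam_middle (hq0 : q ≠ 0) (hq : ∀ m : ℕ, 0 < m → q ^ m ≠ 1) (hc : c ≠ 0) {j : Fin N}
    (hj : j = j.rev) :
    gam q c N j * gam q c N j = c ^ 2 • (1 + ∑ k ∈ Finset.range j,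
        pairScalar q c N k • (gamNat q c N k * gamNat q c N (N - 1 - k))) := by
  have hq2 : q ^ 2 - 1 ≠ 0 := sub_ne_zero.2 (hq 2 (by omega))
  have hq4 : q ^ 2 + 1 ≠ 0 := fun h0 =>
    hq 4 (by omega) (by linear_combination (q ^ 2 - 1) * h0)
  have h := quadratic_relation q c N hq0 hq j.pos j j
  have hj2 : 2 * j.val ≤ N := by
    have := congrArg Fin.val hj
    rw [Fin.val_rev] at this
    omega
  have hC : metricC q N j j = 1 := by
    rw [metricC, if_pos hj, twoRho, if_neg hj.not_lt, if_neg hj.symm.not_lt]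
    simp
  rw [if_pos rfl, if_pos hj, if_neg (lt_irrefl j), sub_self, zero_sub, partial_metric hq2 hc hj2,
    hC, zpow_zero, one_smul, one_smul] at h
  generalize 1 + ∑ k ∈ Finset.range j,
    pairScalar q c N k • (gamNat q c N k * gamNat q c N (N - 1 - k)) = S at *
  have := congrArg (fun x => (q ^ 2 / (q ^ 2 + 1)) • x) h
  simp only [smul_add, smul_neg, smul_smul, smul_zero] at this
  rw [← sub_eq_zero, ← this, ← one_smul ℂ (gam q c N j * gam q c N j)]
  match_scalars <;> field_simp <;> ring

/-- The generators of the FRT--Clifford algebra form pairs. -/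
theorem isPairs (hq0 : q ≠ 0) (hq : ∀ m : ℕ, 0 < m → q ^ m ≠ 1) (hc : c ≠ 0) {n : ℕ}
    (hn : 2 * n ≤ N) :
    IsPairs q n (pairScalar q c N) (gamNat q c N) (fun k => gamNat q c N (N - 1 - k)) where
  a_sq i hi := by
    rw [gamNat_of_lt (by omega)]
    refine gam_mul_self c hq0 hq fun h => ?_
    simp only [Fin.ext_iff, Fin.val_rev] at h
    omega
  b_sq i hi := by
    rw [gamNat_of_lt (by omega)]
    refine gam_mul_self c hq0 hq fun h => ?_
    simp only [Fin.ext_iff, Fin.val_rev] at h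
    omega
  aa i j hij hj := by
    rw [gamNat_of_lt (k := i) (by omega), gamNat_of_lt (k := j) (by omega)]
    refine gam_mul_gam_of_lt c hq0 hq hij fun h => ?_
    simp only [Fin.ext_iff, Fin.val_rev] at h
    omega
  bb i j hij hj := by
    rw [gamNat_of_lt (k := N - 1 - i) (by omega), gamNat_of_lt (k := N - 1 - j) (by omega)]
    refine gam_mul_gam_of_lt c hq0 hq (Fin.mk_lt_mk.2 (by omega)) fun h => ?_
    simp only [Fin.ext_iff, Fin.val_rev] at h
    omega
  ba i j hij hi hj := by
    rw [gamNat_of_lt (k := N - 1 - i) (by omega), gamNat_of_lt (k := j) (by omega)]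
    refine gam_mul_gam_of_lt c hq0 hq (Fin.mk_lt_mk.2 (by omega)) fun h => ?_
    simp only [Fin.ext_iff, Fin.val_rev] at h
    omega
  ab_add_ba i hi := by
    have h := gam_pair hq0 hq hc (N := N) (j := ⟨i, by omega⟩) (by
      rw [Fin.lt_def, Fin.val_rev]
      dsimp only
      omega)
    rw [gamNat_of_lt (k := i) (by omega), gamNat_rev (by omega)]
    exact h

end Pairs

end FRTClifford

namespace FRTClifford

section Central

variable {q c : ℂ} {n : ℕ}

theorem lowProd_eq_ascProd (N : ℕ) (h : n ≤ N) (J : Fin n → Fin 2) :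
    lowProd q c N n h J = ascProd (gamNat q c N) n J := by
  rw [lowProd, ascProd]
  congr 2
  funext i
  rw [gamNat_of_lt (i.isLt.trans_le h)]
  rfl

theorem highProd_eq_descProd (N : ℕ) (h : n ≤ N) (J : Fin n → Fin 2) :
    highProd q c N n h J = descProd (fun k => gamNat q c N (N - 1 - k)) n J := by
  rw [highProd, descProd]
  congr 3
  funext i
  rw [gamNat_rev (i.isLt.trans_le h)]
  rfl

theorem ell_le (J : Fin n → Fin 2) : ell J ≤ n := by
  refine (Finset.sum_le_card_nsmul _ _ 1 fun k _ => by omega).trans ?_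
  simp

theorem sum_ell {M : Type*} [AddCommGroup M] [Module ℂ M] (α : ℕ → ℂ) (f : ℕ → (Fin n → Fin 2) → M) :
    ∑ k ∈ Finset.range (n + 1), α k • ∑ J : Fin n → Fin 2 with ell J = k, f k J =
      ∑ J : Fin n → Fin 2, α (ell J) • f (ell J) J := by
  rw [← Finset.sum_fiberwise_of_maps_to (s := Finset.univ) (t := Finset.range (n + 1)) (g := ell)
    fun J _ => Finset.mem_range.2 (Nat.lt_succ_of_le (ell_le J))]
  refine Finset.sum_congr rfl fun k _ => ?_
  rw [Finset.smul_sum]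
  refine Finset.sum_congr rfl fun J hJ => ?_
  rw [(Finset.mem_filter.1 hJ).2]

theorem interpCoeff_neg_one (hq0 : q ≠ 0) (hq : ∀ m : ℕ, 0 < m → q ^ m ≠ 1) (hc : c ≠ 0) (k : ℕ) :
    ((-1) ^ k * ∏ l ∈ Finset.Icc 1 k,
        (q ^ (2 * (l : ℤ) - 2) + q ^ (-2 * (l : ℤ) + 2)) / (q * (q + q⁻¹) * c ^ 2)) *
      (((q ^ 2 - 1) / c ^ 2)⁻¹ ^ k * q ^ (-(k : ℤ) * (k - 1))) = interpCoeff (q ^ 4) (-1) k := by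
  have hq2 : q ^ 2 - 1 ≠ 0 := sub_ne_zero.2 (hq 2 (by omega))
  have hq2' : q ^ 2 + 1 ≠ 0 := fun h0 =>
    hq 4 (by omega) (by linear_combination (q ^ 2 - 1) * h0)
  induction k with
  | zero => simp [interpCoeff]
  | succ k ih =>
    have e1 : q ^ (2 * ((k + 1 : ℕ) : ℤ) - 2) = q ^ (2 * k) := by
      rw [← zpow_natCast]
      congr 1
      push_cast
      ring
    have e2 : q ^ (-2 * ((k + 1 : ℕ) : ℤ) + 2) = (q ^ (2 * k))⁻¹ := by
      rw [← zpow_natCast, ← zpow_neg]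
      congr 1
      push_cast
      ring
    have e3 : q ^ (-((k + 1 : ℕ) : ℤ) * ((k + 1 : ℕ) - 1)) =
        q ^ (-(k : ℤ) * (k - 1)) * (q ^ (2 * k))⁻¹ := by
      rw [← zpow_natCast, ← zpow_neg, ← zpow_add₀ hq0]
      congr 1
      push_cast
      ring
    have e4 : (q ^ 4) ^ k = q ^ (2 * k) * q ^ (2 * k) := by
      rw [← pow_mul, ← pow_add]
      congr 1
      ring
    have hz : q ^ (2 * k) ≠ 0 := pow_ne_zero _ hq0
    rw [interpCoeff, Finset.prod_range_succ, ← interpCoeff, ← ih, Finset.prod_Icc_succ_top (by omega),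
      e1, e2, e3, e4, pow_succ, pow_succ]
    generalize q ^ (2 * k) = Q at *
    have key : -1 * ((Q + Q⁻¹) / (q * (q + q⁻¹) * c ^ 2)) * (((q ^ 2 - 1) / c ^ 2)⁻¹ * Q⁻¹) =
        (-1 / (Q * Q) - 1) / (q ^ 4 - 1) := by
      have : q * (q + q⁻¹) = q ^ 2 + 1 := by field_simp
      rw [this, show q ^ 4 - 1 = (q ^ 2 - 1) * (q ^ 2 + 1) by ring]
      field_simp
      ring
    rw [← key]
    ring

theorem interpCoeff_neg_inv_sq (hq0 : q ≠ 0) (hq : ∀ m : ℕ, 0 < m → q ^ m ≠ 1) (hc : c ≠ 0) (k : ℕ) :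
    (∏ l ∈ Finset.Icc 1 k,
        (q ^ (2 * (l : ℤ) - 1) + q ^ (-2 * (l : ℤ) + 1)) / (q * (q + q⁻¹) * c ^ 2)) *
      ((-q ^ 2)⁻¹ ^ k * (((q ^ 2 - 1) / c ^ 2)⁻¹ ^ k * q ^ (-(k : ℤ) * (k - 2)))) =
        interpCoeff (q ^ 4) (-q ^ 2)⁻¹ k := by
  have hq2 : q ^ 2 - 1 ≠ 0 := sub_ne_zero.2 (hq 2 (by omega))
  have hq2' : q ^ 2 + 1 ≠ 0 := fun h0 =>
    hq 4 (by omega) (by linear_combination (q ^ 2 - 1) * h0)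
  induction k with
  | zero => simp [interpCoeff]
  | succ k ih =>
    have e1 : q ^ (2 * ((k + 1 : ℕ) : ℤ) - 1) = q ^ (2 * k) * q := by
      rw [← pow_succ, ← zpow_natCast]
      congr 1
      push_cast
      ring
    have e2 : q ^ (-2 * ((k + 1 : ℕ) : ℤ) + 1) = (q ^ (2 * k) * q)⁻¹ := by
      rw [← pow_succ, ← zpow_natCast, ← zpow_neg]
      congr 1
    have e3 : q ^ (-((k + 1 : ℕ) : ℤ) * ((k + 1 : ℕ) - 2)) =
        q ^ (-(k : ℤ) * (k - 2)) * ((q ^ (2 * k))⁻¹ * q) := by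
      have : (q ^ (2 * k))⁻¹ * q = q ^ (-((2 * k : ℕ) : ℤ) + 1) := by
        rw [zpow_add₀ hq0, zpow_neg, zpow_natCast, zpow_one]
      rw [this, ← zpow_add₀ hq0]
      congr 1
      push_cast
      ring
    have e4 : (q ^ 4) ^ k = q ^ (2 * k) * q ^ (2 * k) := by
      rw [← pow_mul, ← pow_add]
      congr 1
      ring
    have hz : q ^ (2 * k) ≠ 0 := pow_ne_zero _ hq0
    rw [interpCoeff, Finset.prod_range_succ, ← interpCoeff, ← ih, Finset.prod_Icc_succ_top (by omega),
      e1, e2, e3, e4, pow_succ, pow_succ]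
    generalize q ^ (2 * k) = Q at *
    have key : (Q * q + (Q * q)⁻¹) / (q * (q + q⁻¹) * c ^ 2) * ((-q ^ 2)⁻¹ *
        (((q ^ 2 - 1) / c ^ 2)⁻¹ * (Q⁻¹ * q))) =
        ((-q ^ 2)⁻¹ / (Q * Q) - 1) / (q ^ 4 - 1) := by
      have : q * (q + q⁻¹) = q ^ 2 + 1 := by field_simp
      rw [this, show q ^ 4 - 1 = (q ^ 2 - 1) * (q ^ 2 + 1) by ring, inv_neg]
      field_simp
      ring
    rw [← key]
    ring

/-- The element `F_n(x)` for the pairs `γ_k`, `γ_{k'}`. -/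
noncomputable abbrev gamInterp (q c : ℂ) (N n : ℕ) (x : ℂ) : Cl q c N :=
  interp (q ^ 4) (fun i => pairScalar q c N i • (gamNat q c N i * gamNat q c N (N - 1 - i))) n x

theorem z0_eq_interp (hq0 : q ≠ 0) (hq : ∀ m : ℕ, 0 < m → q ^ m ≠ 1) (hc : c ≠ 0) :
    z0 q c n = gamInterp q c (2 * n) n (-1) := by
  have hq2 : q ^ 2 - 1 ≠ 0 := sub_ne_zero.2 (hq 2 (by omega))
  have hP := isPairs (N := 2 * n) hq0 hq hc le_rfl
  rw [z0, sum_ell, gamInterp, interp_eq_sum]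
  refine Finset.sum_congr rfl fun J _ => ?_
  rw [lowProd_eq_ascProd, highProd_eq_descProd,
    hP.ascProd_mul_descProd hq0 (2 * n : ℕ) (div_ne_zero hq2 (pow_ne_zero 2 hc)) (fun i _ => rfl) J,
    smul_smul, smul_smul, ← interpCoeff_neg_one hq0 hq hc, mul_assoc]
  congr 2
  rw [mul_left_comm, ← zpow_add₀ hq0]
  congr 2
  push_cast
  ring

theorem z1_eq_interp (hq0 : q ≠ 0) (hq : ∀ m : ℕ, 0 < m → q ^ m ≠ 1) (hc : c ≠ 0) :
    z1 q c n = (1 / c) • (gamInterp q c (2 * n + 1) n (-q ^ 2)⁻¹ *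
      gam q c (2 * n + 1) ⟨n, by omega⟩) := by
  have hq2 : q ^ 2 - 1 ≠ 0 := sub_ne_zero.2 (hq 2 (by omega))
  have hP := isPairs (N := 2 * n + 1) (n := n) hq0 hq hc (by omega)
  rw [z1, sum_ell, gamInterp, interp_eq_sum, Finset.sum_mul]
  congr 1
  refine Finset.sum_congr rfl fun J _ => ?_
  have hg : ∀ i < n, gam q c (2 * n + 1) ⟨n, by omega⟩ * gamNat q c (2 * n + 1) (2 * n + 1 - 1 - i) =
      (-q ^ 2)⁻¹ • (gamNat q c (2 * n + 1) (2 * n + 1 - 1 - i) * gam q c (2 * n + 1) ⟨n, by omega⟩) := by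
    intro i hi
    refine qcomm_symm (by simpa using hq0) ?_
    rw [gamNat_of_lt (by omega)]
    refine gam_mul_gam_of_lt c hq0 hq (Fin.mk_lt_mk.2 (by omega)) fun h => ?_
    simp only [Fin.ext_iff, Fin.val_rev] at h
    omega
  rw [lowProd_eq_ascProd, highProd_eq_descProd, mul_assoc (ascProd _ _ _), mul_descProd n hg J,
    mul_smul_comm, ← mul_assoc (ascProd _ _ _),
    hP.ascProd_mul_descProd hq0 (2 * n + 1 : ℕ) (div_ne_zero hq2 (pow_ne_zero 2 hc))
      (fun i _ => rfl) J, ← interpCoeff_neg_inv_sq hq0 hq hc, smul_mul_assoc, smul_mul_assoc,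
    smul_smul, smul_smul, smul_smul, mul_assoc]
  have he : q ^ (-(ell J : ℤ) * (ell J - 2)) =
      q ^ (2 * (bigL J : ℤ) - (ell J : ℤ) * (2 * (n : ℤ) - ell J + 1)) *
        q ^ (((2 * n + 1 : ℕ) : ℤ) * ell J - 2 * bigL J - 2 * ell J * (ell J - 1)) := by
    rw [← zpow_add₀ hq0]
    congr 1
    push_cast
    ring
  rw [he]
  congr 1
  ring

variable (c) in
/-- Two generators that are not paired commute up to a scalar. -/
theorem gam_qcomm (hq0 : q ≠ 0) (hq : ∀ m : ℕ, 0 < m → q ^ m ≠ 1) {N : ℕ} {i j : Fin N}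
    (h : j ≠ i.rev) : ∃ s : ℂ, gam q c N i * gam q c N j = s • (gam q c N j * gam q c N i) := by
  have hq2 : -q ^ 2 ≠ 0 := by simpa using hq0
  rcases lt_trichotomy i j with hij | rfl | hij
  · exact ⟨_, qcomm_symm hq2 (gam_mul_gam_of_lt c hq0 hq hij h)⟩
  · exact ⟨1, (one_smul _ _).symm⟩
  · refine ⟨_, gam_mul_gam_of_lt c hq0 hq hij fun h' => h ?_⟩
    rw [h', Fin.rev_rev]

theorem gamInterp_mul_prod (hq0 : q ≠ 0) (hq : ∀ m : ℕ, 0 < m → q ^ m ≠ 1) {N m : ℕ}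
    (hm : 2 * n ≤ N) (l : Fin m → Fin N) (hl : ∀ t, N ≤ 2 * (l t).val + 1)
    (hl' : ∀ i < n, ∃ t, (l t).val = N - 1 - i) (x : ℂ) :
    gamInterp q c N n x * (List.ofFn fun t => gam q c N (l t)).prod =
      (List.ofFn fun t => gam q c N (l t)).prod := by
  refine interp_mul_eq_self n (fun i hi => ?_) x
  have hlt : N - 1 - i < N := by omega
  rw [smul_mul_assoc, mul_assoc, gamNat_of_lt hlt, mul_list_prod_eq_zero, mul_zero, smul_zero]
  · refine gam_mul_self c hq0 hq fun h => ?_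
    simp only [Fin.ext_iff, Fin.val_rev] at h
    omega
  · obtain ⟨t, ht⟩ := hl' i hi
    exact (List.mem_ofFn' _ _).2 ⟨t, by simp only [← ht]⟩
  · intro u hu
    obtain ⟨t, rfl⟩ := (List.mem_ofFn' _ _).1 hu
    refine gam_qcomm c hq0 hq fun h => ?_
    have := hl t
    simp only [Fin.ext_iff, Fin.val_rev] at h
    omega

theorem z0_mul_gam (hq0 : q ≠ 0) (hq : ∀ m : ℕ, 0 < m → q ^ m ≠ 1) (hc : c ≠ 0) (i : Fin (2 * n)) :
    z0 q c n * gam q c (2 * n) i = (-1 : ℂ) • (gam q c (2 * n) i * z0 q c n) := by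
  have hq4 : q ^ 4 - 1 ≠ 0 := sub_ne_zero.2 (hq 4 (by omega))
  have hP := isPairs (N := 2 * n) hq0 hq hc le_rfl
  rw [z0_eq_interp hq0 hq hc]
  by_cases hi : i.val < n
  · have := hP.interp_mul_a hq0 hq4 hi (-1)
    rw [gamNat_of_lt i.isLt] at this
    exact this
  · have := hP.b_mul_interp hq0 hq4 (i := 2 * n - 1 - i) (by omega) (-1)
    have hi' : 2 * n - 1 - (2 * n - 1 - i) = i.val := by omega
    rw [hi', gamNat_of_lt i.isLt] at this
    rw [this, smul_smul, neg_one_mul, neg_neg, one_smul]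

theorem z0_mul_prod (hq0 : q ≠ 0) (hq : ∀ m : ℕ, 0 < m → q ^ m ≠ 1) (hc : c ≠ 0)
    (l : List (Fin (2 * n))) :
    z0 q c n * (l.map (gam q c (2 * n))).prod =
      (-1 : ℂ) ^ l.length • ((l.map (gam q c (2 * n))).prod * z0 q c n) := by
  induction l with
  | nil => simp
  | cons i l ih =>
    rw [List.map_cons, List.prod_cons, ← mul_assoc, z0_mul_gam hq0 hq hc, smul_mul_assoc, mul_assoc,
      ih, mul_smul_comm, List.length_cons, pow_succ', mul_smul, mul_assoc]

theorem z0_mul_phiEven (hq0 : q ≠ 0) (hq : ∀ m : ℕ, 0 < m → q ^ m ≠ 1) (hc : c ≠ 0) :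
    z0 q c n * phiEven q c n = phiEven q c n := by
  rw [z0_eq_interp hq0 hq hc]
  refine gamInterp_mul_prod hq0 hq le_rfl _ (fun t => ?_) (fun i hi => ?_) _
  · dsimp only
    omega
  · refine ⟨⟨n - 1 - i, by omega⟩, ?_⟩
    dsimp only
    omega

theorem z0_mul_of_mem_spinPart (hq0 : q ≠ 0) (hq : ∀ m : ℕ, 0 < m → q ^ m ≠ 1) (hc : c ≠ 0)
    {p : ZMod 2} {s : ℂ} (hs : ∀ m : ℕ, (m : ZMod 2) = p → (-1 : ℂ) ^ m = s) {x : Cl q c (2 * n)}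
    (hx : x ∈ spinPart q c n p) : z0 q c n * x = s • x := by
  obtain ⟨y, hy, rfl⟩ := hx
  rw [LinearMap.mulRight_apply]
  induction hy using Submodule.span_induction with
  | mem y hy =>
    obtain ⟨l, hl, rfl⟩ := hy
    rw [← mul_assoc, z0_mul_prod hq0 hq hc, hs _ hl, smul_mul_assoc, mul_assoc,
      z0_mul_phiEven hq0 hq hc]
  | zero => simp
  | add y y' _ _ h h' => rw [add_mul, mul_add, h, h', smul_add]
  | smul t y _ h => rw [smul_mul_assoc, mul_smul_comm, h, smul_comm]

theorem z0_sq (hq0 : q ≠ 0) (hq : ∀ m : ℕ, 0 < m → q ^ m ≠ 1) (hc : c ≠ 0) :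
    z0 q c n ^ 2 = 1 := by
  have hq4 : q ^ 4 - 1 ≠ 0 := sub_ne_zero.2 (hq 4 (by omega))
  rw [z0_eq_interp hq0 hq hc, sq, (isPairs hq0 hq hc le_rfl).interp_mul_interp hq0 hq4,
    neg_one_mul, neg_neg, interp_one]

variable (q c n) in
/-- The middle generator `γ_{n+1}` of `Cl_q(2n+1)`. -/
noncomputable abbrev gamMid : Cl q c (2 * n + 1) := gam q c (2 * n + 1) ⟨n, by omega⟩

theorem gamMid_sq (hq0 : q ≠ 0) (hq : ∀ m : ℕ, 0 < m → q ^ m ≠ 1) (hc : c ≠ 0) :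
    gamMid q c n * gamMid q c n = c ^ 2 • gamInterp q c (2 * n + 1) n (q ^ 4) := by
  have hq4 : q ^ 4 - 1 ≠ 0 := sub_ne_zero.2 (hq 4 (by omega))
  rw [gamInterp, interp_self (pow_ne_zero 4 hq0) hq4, gam_middle hq0 hq hc]
  ext
  simp only [Fin.val_rev]
  omega

theorem a_mul_gamMid (hq0 : q ≠ 0) (hq : ∀ m : ℕ, 0 < m → q ^ m ≠ 1) {i : Fin (2 * n + 1)}
    (hi : i.val < n) : gamMid q c n * gam q c _ i = (-q ^ 2) • (gam q c _ i * gamMid q c n) := by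
  refine gam_mul_gam_of_lt c hq0 hq (Fin.lt_def.2 hi) fun h => ?_
  simp only [Fin.ext_iff, Fin.val_rev] at h
  omega

theorem b_mul_gamMid (hq0 : q ≠ 0) (hq : ∀ m : ℕ, 0 < m → q ^ m ≠ 1) {i : Fin (2 * n + 1)}
    (hi : n < i.val) : gam q c _ i * gamMid q c n = (-q ^ 2) • (gamMid q c n * gam q c _ i) := by
  refine gam_mul_gam_of_lt c hq0 hq (Fin.lt_def.2 hi) fun h => ?_
  simp only [Fin.ext_iff, Fin.val_rev] at h
  omega

theorem commute_gamMid_interp (hq0 : q ≠ 0) (hq : ∀ m : ℕ, 0 < m → q ^ m ≠ 1) (x : ℂ) :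
    Commute (gamMid q c n) (gamInterp q c (2 * n + 1) n x) := by
  refine commute_interp n (fun i hi => Commute.smul_right ?_ _) x
  have hq2 : -q ^ 2 ≠ 0 := by simpa using hq0
  rw [gamNat_of_lt (by omega), gamNat_of_lt (by omega)]
  have := mul_mul_of_qcomm (a_mul_gamMid (c := c) hq0 hq (i := ⟨i, by omega⟩) hi)
    (qcomm_symm hq2 (b_mul_gamMid (c := c) hq0 hq (i := ⟨2 * n + 1 - 1 - i, by omega⟩)
      (by dsimp only; omega)))
  rwa [mul_inv_cancel₀ hq2, one_smul] at this

theorem z1_sq (hq0 : q ≠ 0) (hq : ∀ m : ℕ, 0 < m → q ^ m ≠ 1) (hc : c ≠ 0) :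
    z1 q c n ^ 2 = 1 := by
  have hq4 : q ^ 4 - 1 ≠ 0 := sub_ne_zero.2 (hq 4 (by omega))
  have hP := isPairs (N := 2 * n + 1) (n := n) hq0 hq hc (by omega)
  have hm := hP.interp_mul_interp hq0 hq4
  rw [z1_eq_interp hq0 hq hc, sq, smul_mul_assoc, mul_smul_comm, mul_assoc, ← mul_assoc (gam _ _ _ _),
    (commute_gamMid_interp hq0 hq _).eq, mul_assoc, gamMid_sq hq0 hq hc, mul_smul_comm,
    mul_smul_comm, hm, hm, smul_smul, smul_smul]
  have e1 : (-q ^ 2)⁻¹ * ((-q ^ 2)⁻¹ * q ^ 4) = 1 := by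
    rw [inv_neg]
    field_simp
  rw [e1, interp_one]
  have e2 : 1 / c * (1 / c) * c ^ 2 = 1 := by field_simp
  rw [e2, one_smul]

theorem commute_z1_gam (hq0 : q ≠ 0) (hq : ∀ m : ℕ, 0 < m → q ^ m ≠ 1) (hc : c ≠ 0)
    (i : Fin (2 * n + 1)) : Commute (z1 q c n) (gam q c (2 * n + 1) i) := by
  have hq4 : q ^ 4 - 1 ≠ 0 := sub_ne_zero.2 (hq 4 (by omega))
  have hq2 : -q ^ 2 ≠ 0 := by simpa using hq0
  have hP := isPairs (N := 2 * n + 1) (n := n) hq0 hq hc (by omega)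
  rw [z1_eq_interp hq0 hq hc]
  refine Commute.smul_left ?_ _
  rcases lt_trichotomy i.val n with hi | hi | hi
  · have h1 := hP.interp_mul_a hq0 hq4 hi (-q ^ 2)⁻¹
    rw [gamNat_of_lt i.isLt] at h1
    rw [Commute, SemiconjBy, mul_assoc, a_mul_gamMid hq0 hq hi, mul_smul_comm, ← mul_assoc, h1,
      smul_mul_assoc, smul_smul, mul_inv_cancel₀ hq2, one_smul, mul_assoc]
  · rw [show i = ⟨n, by omega⟩ from Fin.ext hi]
    exact (commute_gamMid_interp hq0 hq _).symm.mul_left (Commute.refl _)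
  · have h1 := hP.b_mul_interp hq0 hq4 (i := 2 * n + 1 - 1 - i) (by omega) (-q ^ 2)⁻¹
    have hi' : 2 * n + 1 - 1 - (2 * n + 1 - 1 - i) = i.val := by omega
    rw [hi', gamNat_of_lt i.isLt] at h1
    rw [Commute, SemiconjBy, ← mul_assoc (gam _ _ _ _), h1, smul_mul_assoc, mul_assoc, mul_assoc,
      b_mul_gamMid hq0 hq hi, mul_smul_comm, smul_smul, inv_mul_cancel₀ hq2, one_smul]

theorem commute_of_commute_gam {N : ℕ} {z : Cl q c N} (h : ∀ i, Commute z (gam q c N i))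
    (x : Cl q c N) : Commute z x := by
  obtain ⟨y, rfl⟩ := RingQuot.mkAlgHom_surjective ℂ (Rel q c N) x
  induction y using FreeAlgebra.induction with
  | grade0 r =>
    rw [AlgHom.commutes]
    exact (Algebra.commutes r z).symm
  | grade1 i => exact h i
  | mul a b ha hb =>
    rw [map_mul]
    exact ha.mul_right hb
  | add a b ha hb =>
    rw [map_add]
    exact ha.add_right hb

theorem z1_mul_phiOdd (hq0 : q ≠ 0) (hq : ∀ m : ℕ, 0 < m → q ^ m ≠ 1) (hc : c ≠ 0) {ν : ℂ}
    (hν : ν * ν = 1) : z1 q c n * phiOdd q c n ν = ν • phiOdd q c n ν := by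
  have hB : ∀ x, gamInterp q c (2 * n + 1) n x *
      (List.ofFn fun t : Fin n => gam q c (2 * n + 1) ⟨n + 1 + t, by omega⟩).prod =
      (List.ofFn fun t : Fin n => gam q c (2 * n + 1) ⟨n + 1 + t, by omega⟩).prod := fun x => by
    refine gamInterp_mul_prod hq0 hq (by omega) _ (fun t => ?_) (fun i hi => ?_) x
    · dsimp only
      omega
    · refine ⟨⟨n - 1 - i, by omega⟩, ?_⟩
      dsimp only
      omega
  rw [z1_eq_interp hq0 hq hc, phiOdd]
  generalize (List.ofFn fun t : Fin n => gam q c (2 * n + 1) ⟨n + 1 + t, by omega⟩).prod = B at *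
  have hF := commute_gamMid_interp (c := c) (n := n) hq0 hq (-q ^ 2)⁻¹
  have h1 : gamMid q c n * (gamMid q c n * B) = c ^ 2 • B := by
    rw [← mul_assoc, gamMid_sq hq0 hq hc, smul_mul_assoc, hB]
  have h2 : gamInterp q c (2 * n + 1) n (-q ^ 2)⁻¹ * (gamMid q c n * B) = gamMid q c n * B := by
    rw [← mul_assoc, ← hF.eq, mul_assoc, hB]
  rw [← hF.eq, add_mul, ← Algebra.smul_def, smul_mul_assoc, mul_assoc, mul_add, mul_smul_comm, hB,
    h2, mul_add, mul_smul_comm, h1]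
  match_scalars
  · field_simp
  · field_simp
    linear_combination -hν

theorem z1_mul_of_mem_leftIdealOdd (hq0 : q ≠ 0) (hq : ∀ m : ℕ, 0 < m → q ^ m ≠ 1) (hc : c ≠ 0)
    {ν : ℂ} (hν : ν * ν = 1) {x : Cl q c (2 * n + 1)} (hx : x ∈ leftIdealOdd q c n ν) :
    z1 q c n * x = ν • x := by
  obtain ⟨y, rfl⟩ := Ideal.mem_span_singleton'.1 hx
  rw [← mul_assoc, (commute_of_commute_gam (commute_z1_gam hq0 hq hc) y).eq, mul_assoc,
    z1_mul_phiOdd hq0 hq hc hν, mul_smul_comm]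

end Central

end FRTClifford

theorem mainTheorem10 (q c : ℂ) (hq0 : q ≠ 0) (hq : ∀ m : ℕ, 0 < m → q ^ m ≠ 1)
    (hc : ∃ r : ℝ, r ≠ 0 ∧ c ^ 2 = (r : ℂ)) (n : ℕ) :
    (3 ≤ 2 * n →
      FRTClifford.z0 q c n ^ 2 = 1 ∧
      (∀ x ∈ FRTClifford.spinPart q c n 0, FRTClifford.z0 q c n * x = x) ∧
      (∀ x ∈ FRTClifford.spinPart q c n 1, FRTClifford.z0 q c n * x = -x)) ∧
    (3 ≤ 2 * n + 1 →
      FRTClifford.z1 q c n ^ 2 = 1 ∧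
      (∀ x ∈ FRTClifford.leftIdealOdd q c n 1, FRTClifford.z1 q c n * x = x) ∧
      (∀ x ∈ FRTClifford.leftIdealOdd q c n (-1), FRTClifford.z1 q c n * x = -x)) := by
  have hc0 : c ≠ 0 := by
    rintro rfl
    obtain ⟨r, hr, h⟩ := hc
    rw [zero_pow two_ne_zero] at h
    exact hr (by exact_mod_cast h.symm)
  refine ⟨fun _ => ⟨FRTClifford.z0_sq hq0 hq hc0, fun x hx => ?_, fun x hx => ?_⟩,
    fun _ => ⟨FRTClifford.z1_sq hq0 hq hc0, fun x hx => ?_, fun x hx => ?_⟩⟩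
  · rw [FRTClifford.z0_mul_of_mem_spinPart hq0 hq hc0 (fun m hm => ?_) hx, one_smul]
    exact ((ZMod.natCast_eq_zero_iff_even).1 hm).neg_one_pow
  · rw [FRTClifford.z0_mul_of_mem_spinPart hq0 hq hc0 (fun m hm => ?_) hx]
    · exact neg_one_smul ℂ x
    exact ((ZMod.natCast_eq_one_iff_odd).1 hm).neg_one_pow
  · rw [FRTClifford.z1_mul_of_mem_leftIdealOdd hq0 hq hc0 (by norm_num) hx, one_smul]
  · rw [FRTClifford.z1_mul_of_mem_leftIdealOdd hq0 hq hc0 (by norm_num) hx]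
    exact neg_one_smul ℂ x
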